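/- Let $k$ be an algebraically closed field, let $n+2\le s\le 2n$, and let $\Gamma\subset\mathbb{P}^n_k$ be a set of $s$ distinct points in general linear position (no $n+1$ of them lie on a hyperplane). For a finite set $\Gamma'\subset\mathbb P^n_k$ let $J(\Gamma')=\bigcap_{p\in\Gamma'}I(p)\subset k[x_0,\dots,x_n]$ be its homogeneous ideal, where $I(p)$ is generated by the forms vanishing at $p$, and let $\mu$ denote the minimal number of generators of an ideal. Put $T=\{t\in\mathbb{Z} : 2n-s+1\le t\le n-1\}$ and $$\Lambda=\{(i,j) : 0\le i<j\le n,\ (i,j)\ne(t,n)\ \text{for all } t\in T\}.$$ Then: 1. There is a projective change of coordinates $A$ such that $A\Gamma$ contains the $n+1$ coordinate points and the point $[1:\cdots:1]$. 2. For every such $A$, the ideal $J(A\Gamma)$ is minimally generated (no proper subfamily generates it) by quadrics of the form $$g_{ij}=x_ix_j+\sum_{t\in T}\alpha^{(t)}_{ij}\,x_tx_n,\qquad (i,j)\in\Lambda,$$ with $\alpha^{(t)}_{ij}\in k$, and the coefficients are uniquely determined by the points: they are the only ones for which all these quadrics vanish on $A\Gamma$. 3. $\mu(J(\Gamma))=|\Lambda|=\binom{n+1}{2}-(s-(n+1))=\binom{n+2}{2}-s$;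 in particular $\binom n2+1\le\mu(J(\Gamma))\le\binom{n+1}{2}+1$. -/

import Mathlib

open MvPolynomial

/-- Homogeneous coordinates for the projective space of dimension `n` over `k`: the points are the
lines through the origin of `k ^ (n + 1)`. -/
abbrev ProjSpace (k : Type*) [Field k] (n : ℕ) : Type _ :=
  Projectivization k (Fin (n + 1) → k)

/-- The hyperplane of `P^n` cut out by a linear form (which is a genuine hyperplane when `ℓ ≠ 0`). -/
def hyperplane {k : Type*} [Field k] {n : ℕ} (ℓ : Module.Dual k (Fin (n + 1) → k)) :
    Set (ProjSpace k n) :=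
  {p | p.submodule ≤ LinearMap.ker ℓ}

/-- Points of `P^n` in general linear position: either there are `s ≤ n` of them and they span a
projective subspace of dimension `s - 1` (a vector subspace of dimension `s`), or there are at least
`n + 1` of them and no `n + 1` of them lie on a hyperplane. -/
def InGeneralLinearPosition {k : Type*} [Field k] {n : ℕ} (Γ : Set (ProjSpace k n)) : Prop :=
  (Γ.encard ≤ n ∧
      (Module.finrank k (⨆ p ∈ Γ, p.submodule : Submodule k (Fin (n + 1) → k)) : ℕ∞) = Γ.encard) ∨
    ((n : ℕ∞) + 1 ≤ Γ.encard ∧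
      ∀ S ⊆ Γ, S.encard = (n : ℕ∞) + 1 →
        ∀ ℓ : Module.Dual k (Fin (n + 1) → k), ℓ ≠ 0 → ¬ S ⊆ hyperplane ℓ)

/-- The homogeneous prime ideal `I(p)` of a point: generated by the forms vanishing at `p`. -/
noncomputable def pointIdeal {k : Type*} [Field k] {n : ℕ} (p : ProjSpace k n) :
    Ideal (MvPolynomial (Fin (n + 1)) k) :=
  Ideal.span {f | (∃ d : ℕ, f.IsHomogeneous d) ∧ ∀ v ∈ p.submodule, v ≠ 0 → eval v f = 0}

/-- The ideal of a set of points: the intersection of the ideals of its points. -/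
noncomputable def idealOfPoints {k : Type*} [Field k] {n : ℕ} (Γ : Set (ProjSpace k n)) :
    Ideal (MvPolynomial (Fin (n + 1)) k) :=
  ⨅ p ∈ Γ, pointIdeal p

/-- The set of points obtained from `Γ` by the projective change of coordinates induced by `A`. -/
def changeCoordinates {k : Type*} [Field k] {n : ℕ}
    (A : (Fin (n + 1) → k) ≃ₗ[k] (Fin (n + 1) → k)) (Γ : Set (ProjSpace k n)) :
    Set (ProjSpace k n) :=
  Projectivization.map (A : (Fin (n + 1) → k) →ₗ[k] (Fin (n + 1) → k)) A.injective '' Γ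

/-- The coordinate points `[1 : 0 : ⋯ : 0], …, [0 : ⋯ : 0 : 1]` and the unit point `[1 : ⋯ : 1]`
all belong to `Γ`. -/
def ContainsStandardFrame {k : Type*} [Field k] {n : ℕ} (Γ : Set (ProjSpace k n)) : Prop :=
  (∀ i : Fin (n + 1), Projectivization.mk k (Pi.single i (1 : k) : Fin (n + 1) → k)
      (by simp) ∈ Γ) ∧
    Projectivization.mk k (1 : Fin (n + 1) → k) one_ne_zero ∈ Γ

/-- The integers `t` in the interval `[2n - s + 1, n - 1]`, as indices of variables. -/
def tailIndices (n s : ℕ) : Finset (Fin (n + 1)) :=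
  {t | 2 * n - s + 1 ≤ (t : ℕ) ∧ (t : ℕ) < n}

/-- The set `Λ` of pairs `(i, j)` with `0 ≤ i < j ≤ n` that are not of the form `(t, n)` with
`t ∈ [2n - s + 1, n - 1]`. -/
def quadricIndices (n s : ℕ) : Finset (Fin (n + 1) × Fin (n + 1)) :=
  {ij | ij.1 < ij.2 ∧ ∀ t ∈ tailIndices n s, ij ≠ (t, Fin.last n)}

/-- The quadric `g_ij = x_i x_j + ∑_t α_ij^(t) x_t x_n`. -/
noncomputable def quadric {k : Type*} [Field k] {n s : ℕ}
    (α : quadricIndices n s → tailIndices n s → k) (ij : quadricIndices n s) :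
    MvPolynomial (Fin (n + 1)) k :=
  X ij.1.1 * X ij.1.2 + ∑ t : tailIndices n s, C (α ij t) * X t.1 * X (Fin.last n)

/-- The family `g` generates the ideal `J` and no proper subfamily generates it. -/
def IsMinimalGeneratingFamily {R ι : Type*} [CommRing R] (J : Ideal R) (g : ι → R) : Prop :=
  Ideal.span (Set.range g) = J ∧ ∀ S : Set ι, Ideal.span (g '' S) = J → S = Set.univ

/-- The minimal number `μ(J)` of generators of a (finitely generated) ideal. -/
noncomputable def minNumGenerators {R : Type*} [CommRing R] (J : Ideal R) : ℕ :=
  Submodule.spanFinrank J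

/-! Besides the coordinate points, `Γ` has exactly `s - (n + 1) = |T|` points; call this set `P`. A
form in the `x_t`, `t ∈ T`, that vanishes on `P` also vanishes at the coordinate points outside `T`,
so at `n + 1` points of `Γ`, and is zero. Since no point of `P` lies on `x_n = 0`, the square matrix
`(x_t x_n)(p)` is invertible. This determines the `α` and puts the `g_ij` in `J`.

Let `Q` be the ideal of the `g_ij`. Modulo `Q` every `x_i x_j` is a combination of the `x_t x_n`,
and general position makes every coefficient of `x_0 x_n` nonzero. Multiplying that relation by
`x_t` therefore expresses `x_t² x_n` as well, so the `x_t x_n` span the ideal of all `x_i x_j`, `i ≠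
j`, over `k[x_n]` modulo `Q` (`exists_sub_sum_mem_of_relations`). An `f ∈ J` lies in that ideal;
evaluating its remainder on the lines of `P` and inverting the same matrix shows that the remainder
is zero, so `J = Q` (`exists_quadric_span_eq`).

Minimality is Nakayama's argument in degree 2, read off from the coefficients at the monomials `x_i
x_j` with `(i, j) ∈ Λ` (`span_coeffs_image_eq_top`). -/

/-! ### Ideals of points as vanishing ideals of lines -/

theorem eval_smul_of_isHomogeneous {k σ : Type*} [CommRing k] [Fintype σ] {f : MvPolynomial σ k}
    {d : ℕ} (hf : f.IsHomogeneous d) (c : k) (v : σ → k) :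
    eval (c • v) f = c ^ d * eval v f := by
  rw [eval_eq', eval_eq', Finset.mul_sum]
  refine Finset.sum_congr rfl fun m hm => ?_
  have hd : ∑ i, m i = d := by
    rw [← Finsupp.degree_eq_sum, Finsupp.degree_eq_weight_one]
    exact hf (mem_support_iff.1 hm)
  simp only [Pi.smul_apply, smul_eq_mul, mul_pow, Finset.prod_mul_distrib]
  rw [Finset.prod_pow_eq_pow_sum, hd]
  ring

/-- The values `f_d(v)` are the coefficients of the polynomial `c ↦ f(cv)`, which vanishes on an
infinite field. -/
theorem eval_homogeneousComponent_eq_zero {k σ : Type*} [Field k] [Infinite k] [Fintype σ]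
    {f : MvPolynomial σ k} {v : σ → k} (hf : ∀ c : k, eval (c • v) f = 0) (d : ℕ) :
    eval v (homogeneousComponent d f) = 0 := by
  let g : Polynomial k := ∑ i ∈ Finset.range (f.totalDegree + 1),
    Polynomial.monomial i (eval v (homogeneousComponent i f))
  have hg : g = 0 := by
    refine Polynomial.funext fun c => ?_
    rw [Polynomial.eval_zero, ← hf c]
    conv_rhs => rw [← sum_homogeneousComponent f]
    simp only [g, Polynomial.eval_finsetSum, Polynomial.eval_monomial, map_sum,
      eval_smul_of_isHomogeneous (homogeneousComponent_isHomogeneous _ f)]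
    exact Finset.sum_congr rfl fun _ _ => mul_comm _ _
  by_cases hd : d < f.totalDegree + 1
  · have h := congrArg (Polynomial.coeff · d) hg
    simpa [g, Polynomial.finsetSum_coeff, Polynomial.coeff_monomial, Finset.sum_ite_eq',
      Finset.mem_range, hd] using h
  · rw [homogeneousComponent_eq_zero d f (by omega), map_zero]

theorem mem_pointIdeal_iff {k : Type*} [Field k] [Infinite k] {n : ℕ} (p : ProjSpace k n)
    (f : MvPolynomial (Fin (n + 1)) k) :
    f ∈ pointIdeal p ↔ ∀ v ∈ p.submodule, eval v f = 0 := by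
  constructor
  · intro hf v hv
    induction hf using Submodule.span_induction with
    | mem f hf =>
      obtain ⟨⟨d, hd⟩, h0⟩ := hf
      by_cases hv0 : v = 0
      · have h := h0 p.rep (by rw [p.submodule_eq]; exact Submodule.mem_span_singleton_self _)
          p.rep_nonzero
        have h2 := eval_smul_of_isHomogeneous hd 0 p.rep
        rwa [h, mul_zero, zero_smul, ← hv0] at h2
      · exact h0 v hv hv0
    | zero => simp
    | add f g _ _ hf hg => rw [map_add, hf, hg, add_zero]
    | smul a f _ hf => rw [smul_eq_mul, map_mul, hf, mul_zero]
  · intro hf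
    rw [← sum_homogeneousComponent f]
    refine Ideal.sum_mem _ fun d _ => Ideal.subset_span ⟨⟨d, homogeneousComponent_isHomogeneous d f⟩,
      fun v hv _ => eval_homogeneousComponent_eq_zero (fun c => hf _ (Submodule.smul_mem _ c hv)) d⟩

theorem mem_idealOfPoints_iff {k : Type*} [Field k] [Infinite k] {n : ℕ} {Γ : Set (ProjSpace k n)}
    {f : MvPolynomial (Fin (n + 1)) k} :
    f ∈ idealOfPoints Γ ↔ ∀ p ∈ Γ, ∀ v ∈ p.submodule, eval v f = 0 := by
  simp only [idealOfPoints, Ideal.mem_iInf, mem_pointIdeal_iff]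

/-! ### Reduction to products of distinct variables, and modulo the quadrics -/

/-- A polynomial vanishing on all coordinate axes lies in the ideal of the products `x_i x_j`. -/
theorem mem_span_X_mul_X_of_eval_single {k σ : Type*} [Field k] [Infinite k] [Fintype σ]
    [DecidableEq σ] [Nonempty σ] {f : MvPolynomial σ k}
    (hf : ∀ (i : σ) (c : k), eval (Pi.single i c) f = 0) :
    f ∈ Ideal.span {g | ∃ i j : σ, i ≠ j ∧ g = X i * X j} := by
  have hcoeff : ∀ (i : σ) (d : ℕ), coeff (Finsupp.single i d) f = 0 := by
    intro i d
    -- Restriction to the `i`-th axis: only pure powers of `X i` survive, so `φ f = 0` kills their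
    -- coefficients in `f`.
    let φ : MvPolynomial σ k →ₐ[k] Polynomial k := aeval (Pi.single i Polynomial.X)
    have hφ : φ f = 0 := by
      refine Polynomial.funext fun c => ?_
      rw [Polynomial.eval_zero, ← hf i c, ← Polynomial.coe_aeval_eq_eval, ← coe_aeval_eq_eval]
      change ((Polynomial.aeval c).comp φ) f = aeval (Pi.single i c) f
      congr 1
      refine MvPolynomial.algHom_ext fun j => ?_
      by_cases h : j = i
      · subst h; simp [φ]
      · simp [φ, h]
    have key : ∀ g : MvPolynomial σ k, (φ g).coeff d = coeff (Finsupp.single i d) g := by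
      intro g
      induction g using MvPolynomial.induction_on' with
      | add p q hp hq => rw [map_add, Polynomial.coeff_add, hp, hq, coeff_add]
      | monomial m a =>
        rw [coeff_monomial, aeval_monomial, Polynomial.algebraMap_eq, Polynomial.coeff_C_mul,
          Finsupp.prod_fintype _ _ (fun _ => pow_zero _)]
        by_cases hm : ∃ j, j ≠ i ∧ m j ≠ 0
        · obtain ⟨j, hj, hmj⟩ := hm
          rw [Finset.prod_eq_zero (Finset.mem_univ j) (by simp [hj, hmj]), Polynomial.coeff_zero,
            mul_zero, if_neg]
          rintro rfl
          simp [Ne.symm hj] at hmj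
        · push Not at hm
          rw [Finset.prod_eq_single i (fun j _ hj => by rw [hm j hj, pow_zero]) (by simp)]
          have hmi : m = Finsupp.single i (m i) := by
            ext j
            by_cases h : j = i
            · subst h; simp
            · simp [hm j h, h]
          rw [Pi.single_eq_same, Polynomial.coeff_X_pow]
          by_cases h : d = m i
          · rw [if_pos h, if_pos (by rw [h, ← hmi]), mul_one]
          · rw [if_neg h, if_neg, mul_zero]
            intro h2
            rw [h2] at h
            simp at h
    rw [← key, hφ, Polynomial.coeff_zero]
  have hset : {g : MvPolynomial σ k | ∃ i j : σ, i ≠ j ∧ g = X i * X j} =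
      (fun s => monomial s (1 : k)) ''
        {s | ∃ i j : σ, i ≠ j ∧ s = Finsupp.single i 1 + Finsupp.single j 1} := by
    ext g
    constructor
    · rintro ⟨i, j, hij, rfl⟩
      exact ⟨_, ⟨i, j, hij, rfl⟩, by simp [X, monomial_mul]⟩
    · rintro ⟨_, ⟨i, j, hij, rfl⟩, rfl⟩
      exact ⟨i, j, hij, by simp [X, monomial_mul]⟩
  rw [hset, mem_ideal_span_monomial_image]
  intro m hm
  have hne : ∀ i d, m ≠ Finsupp.single i d := by
    rintro i d rfl
    exact mem_support_iff.1 hm (hcoeff i d)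
  obtain ⟨i, hi⟩ : ∃ i, m i ≠ 0 := by
    by_contra! h
    obtain ⟨i⟩ := ‹Nonempty σ›
    exact hne i 0 (by ext j; simp [h j])
  obtain ⟨j, hji, hj⟩ : ∃ j, j ≠ i ∧ m j ≠ 0 := by
    by_contra! h
    refine hne i (m i) ?_
    ext j
    by_cases hji : j = i
    · subst hji; simp
    · simp [h j hji, hji]
  refine ⟨_, ⟨i, j, hji.symm, rfl⟩, fun l => ?_⟩
  simp only [Finsupp.add_apply, Finsupp.single_apply]
  split_ifs with h1 h2 h2
  · exact absurd (h2.trans h1.symm) hji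
  · subst h1; omega
  · subst h2; omega
  · omega

/-- Modulo relations expressing the `x_i x_j` through the `x_t x_ν` with `t ∈ T`, the ideal of the
products `x_i x_j` is spanned over `k[x_ν]` by the `x_t x_ν`. -/
theorem exists_sub_sum_mem_of_relations {k σ : Type*} [Field k] [DecidableEq σ]
    (Q : Ideal (MvPolynomial σ k)) (T : Finset σ) (ν o : σ) (ho : o ∉ T)
    (hrel : ∀ i j : σ, i ≠ j → ∃ a : σ → k, X i * X j - ∑ t ∈ T, C (a t) * X t * X ν ∈ Q)
    (b : σ → k) (hb : ∀ t ∈ T, b t ≠ 0)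
    (hbQ : X o * X ν - ∑ t ∈ T, C (b t) * X t * X ν ∈ Q)
    {f : MvPolynomial σ k} (hf : f ∈ Ideal.span {g | ∃ i j : σ, i ≠ j ∧ g = X i * X j}) :
    ∃ h : σ → Polynomial k, f - ∑ t ∈ T, X t * X ν * Polynomial.aeval (X ν) (h t) ∈ Q := by
  -- `M` is `Q` plus the `k[x_ν]`-span of the `x_t x_ν`. It contains every `x_i x_j` with `i ≠ j`,
  -- so it suffices that it be closed under multiplication by each variable.
  let M : Set (MvPolynomial σ k) := {f | ∃ h : σ → Polynomial k,
    f - ∑ t ∈ T, X t * X ν * Polynomial.aeval (X ν) (h t) ∈ Q}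
  have hM0 : ∀ f ∈ Q, f ∈ M := fun f hf => ⟨0, by simpa using hf⟩
  have hMadd : ∀ f ∈ M, ∀ g ∈ M, f + g ∈ M := by
    rintro f ⟨h, hf⟩ g ⟨h', hg⟩
    refine ⟨h + h', ?_⟩
    convert Q.add_mem hf hg using 1
    simp only [Pi.add_apply, map_add, mul_add, Finset.sum_add_distrib]
    ring
  have hMmul : ∀ (p : Polynomial k), ∀ f ∈ M, Polynomial.aeval (X ν) p * f ∈ M := by
    rintro p f ⟨h, hf⟩
    refine ⟨fun t => p * h t, ?_⟩
    convert Q.mul_mem_left (Polynomial.aeval (X ν) p) hf using 1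
    rw [mul_sub, Finset.mul_sum]
    congr 1
    refine Finset.sum_congr rfl fun t _ => ?_
    rw [map_mul]
    ring
  have hMX : ∀ f ∈ M, X ν * f ∈ M := fun f hf => by simpa using hMmul Polynomial.X f hf
  have hMC : ∀ c : k, ∀ f ∈ M, C c * f ∈ M := fun c f hf => by
    simpa [MvPolynomial.algebraMap_eq] using hMmul (Polynomial.C c) f hf
  have hMsum : ∀ (s : Finset σ) (F : σ → MvPolynomial σ k), (∀ t ∈ s, F t ∈ M) →
      ∑ t ∈ s, F t ∈ M := by
    intro s F
    induction s using Finset.induction_on with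
    | empty => intro _; simpa using hM0 0 Q.zero_mem
    | insert a s ha ih =>
      intro h
      rw [Finset.sum_insert ha]
      exact hMadd _ (h a (Finset.mem_insert_self _ _)) _
        (ih fun t ht => h t (Finset.mem_insert_of_mem ht))
  have hMT : ∀ t ∈ T, X t * X ν ∈ M := by
    intro t ht
    refine ⟨Pi.single t 1, ?_⟩
    rw [Finset.sum_eq_single t (fun u _ hu => by simp [hu]) (fun h => absurd ht h)]
    simp
  have hMij : ∀ i j, i ≠ j → X i * X j ∈ M := by
    intro i j hij
    obtain ⟨a, ha⟩ := hrel i j hij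
    rw [← sub_add_cancel (X i * X j) (∑ t ∈ T, C (a t) * X t * X ν)]
    refine hMadd _ (hM0 _ ha) _ (hMsum _ _ fun t ht => ?_)
    rw [mul_assoc]
    exact hMC _ _ (hMT t ht)
  -- The one product that `hrel` does not reduce: multiply the relation for `x_o x_ν` by `x_t`,
  -- solve for the square using `b t ≠ 0`, and reduce the mixed products `x_t x_o` and `x_t x_u`.
  have hsq : ∀ t ∈ T, X t * (X t * X ν) ∈ M := by
    intro t ht
    have h1 : C (b t) * (X t * (X t * X ν)) = X ν * (X t * X o) +
        ((-X t) * (X o * X ν - ∑ t ∈ T, C (b t) * X t * X ν) +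
        ∑ u ∈ T.erase t, C (-b u) * (X ν * (X t * X u))) := by
      rw [← Finset.add_sum_erase _ _ ht]
      have : ∑ u ∈ T.erase t, C (-b u) * (X ν * (X t * X u)) =
          (-X t) * ∑ u ∈ T.erase t, (C (b u) * X u * X ν) := by
        rw [Finset.mul_sum]
        exact Finset.sum_congr rfl fun u _ => by rw [map_neg]; ring
      rw [this]
      ring
    have h2 : X t * (X t * X ν) = C (b t)⁻¹ * (C (b t) * (X t * (X t * X ν))) := by
      rw [← mul_assoc (C _), ← C_mul, inv_mul_cancel₀ (hb t ht), C_1, one_mul]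
    rw [h2, h1]
    refine hMC _ _ (hMadd _ (hMX _ (hMij t o fun h => ho (h ▸ ht))) _
      (hMadd _ (hM0 _ (Q.mul_mem_left _ hbQ)) _ (hMsum _ _ fun u hu => ?_)))
    exact hMC _ _ (hMX _ (hMij _ _ (Finset.ne_of_mem_erase hu).symm))
  have hXT : ∀ l, ∀ t ∈ T, X l * (X t * X ν) ∈ M := by
    intro l t ht
    by_cases hlt : l = t
    · exact hlt ▸ hsq t ht
    · have := hMX _ (hMij l t hlt)
      convert this using 1
      ring
  have hX : ∀ l, ∀ f ∈ M, X l * f ∈ M := by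
    rintro l f ⟨h, hf⟩
    rw [← sub_add_cancel f (∑ t ∈ T, X t * X ν * Polynomial.aeval (X ν) (h t)), mul_add]
    refine hMadd _ (hM0 _ (Q.mul_mem_left _ hf)) _ ?_
    rw [Finset.mul_sum]
    refine hMsum _ _ fun t ht => ?_
    have := hMmul (h t) _ (hXT l t ht)
    convert this using 1
    ring
  have hMideal : ∀ g, ∀ f ∈ M, g * f ∈ M := by
    intro g
    induction g using MvPolynomial.induction_on with
    | C a => exact hMC a
    | add p q hp hq =>
      intro f hf
      rw [add_mul]
      exact hMadd _ (hp f hf) _ (hq f hf)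
    | mul_X p i hp =>
      intro f hf
      rw [mul_assoc]
      exact hp _ (hX i f hf)
  change f ∈ M
  induction hf using Submodule.span_induction with
  | mem f hf => obtain ⟨i, j, hij, rfl⟩ := hf; exact hMij i j hij
  | zero => exact hM0 0 Q.zero_mem
  | add f g _ _ hf hg => exact hMadd f hf g hg
  | smul a f _ hf => exact hMideal a f hf

/-! ### Minimality from coefficients in the lowest degree -/

theorem coeff_eq_zero_of_mem_span_of_isHomogeneous {k σ ι : Type*} [CommRing k]
    {g : ι → MvPolynomial σ k} {d : ℕ} (hg : ∀ i, (g i).IsHomogeneous d) {f : MvPolynomial σ k}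
    (hf : f ∈ Ideal.span (Set.range g)) {m : σ →₀ ℕ} (hm : m.degree < d) : coeff m f = 0 := by
  classical
  induction hf using Submodule.span_induction generalizing m with
  | mem f hf => obtain ⟨i, rfl⟩ := hf; exact (hg i).coeff_eq_zero hm.ne
  | zero => simp
  | add f g _ _ hf hg => rw [coeff_add, hf hm, hg hm, add_zero]
  | smul a f _ hf =>
    rw [smul_eq_mul, coeff_mul]
    refine Finset.sum_eq_zero fun x hx => ?_
    rw [hf, mul_zero]
    have := congrArg Finsupp.degree (Finset.HasAntidiagonal.mem_antidiagonal.1 hx)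
    rw [map_add] at this
    omega

theorem coeff_mul_of_mem_span_of_isHomogeneous {k σ ι : Type*} [CommRing k]
    {g : ι → MvPolynomial σ k} {d : ℕ} (hg : ∀ i, (g i).IsHomogeneous d) {f : MvPolynomial σ k}
    (hf : f ∈ Ideal.span (Set.range g)) (a : MvPolynomial σ k) {m : σ →₀ ℕ} (hm : m.degree = d) :
    coeff m (a * f) = coeff 0 a * coeff m f := by
  classical
  rw [coeff_mul]
  refine Finset.sum_eq_single (0, m) (fun x hx hne => ?_) (by simp)
  rw [Finset.HasAntidiagonal.mem_antidiagonal] at hx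
  have h := congrArg Finsupp.degree hx
  rw [map_add] at h
  have hx1 : x.1.degree ≠ 0 := by
    intro h0
    rw [Finsupp.degree_eq_zero_iff] at h0
    rw [h0, zero_add] at hx
    exact hne (Prod.ext h0 hx)
  rw [coeff_eq_zero_of_mem_span_of_isHomogeneous hg hf (by omega), mul_zero]

/-- The coefficients at a family of monomials, as a linear map. -/
noncomputable def coeffs (k : Type*) {σ ι : Type*} [CommRing k] (m : ι → σ →₀ ℕ) :
    MvPolynomial σ k →ₗ[k] ι → k :=
  LinearMap.pi fun i => lcoeff k (m i)

/-- On the ideal, multiplication by `a` acts on coefficient vectors as the scalar `a(0)`, so the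
vectors of any generating set span those of the whole ideal, among them all unit vectors. This
yields both irredundancy and the lower bound for `μ`. -/
theorem span_coeffs_image_eq_top {k σ ι : Type*} [CommRing k] [Fintype ι] [DecidableEq ι]
    {g : ι → MvPolynomial σ k} {d : ℕ} (hg : ∀ i, (g i).IsHomogeneous d) {m : ι → σ →₀ ℕ}
    (hm : ∀ i, (m i).degree = d) (hgm : ∀ i, coeffs k m (g i) = Pi.single i 1)
    {S : Set (MvPolynomial σ k)} (hS : Ideal.span S = Ideal.span (Set.range g)) :
    Submodule.span k (coeffs k m '' S) = ⊤ := by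
  have key : ∀ f ∈ Ideal.span S, coeffs k m f ∈ Submodule.span k (coeffs k m '' S) := by
    intro f hf
    induction hf using Submodule.span_induction with
    | mem f hf => exact Submodule.subset_span ⟨f, hf, rfl⟩
    | zero => simp
    | add f g _ _ hf hg => rw [map_add]; exact Submodule.add_mem _ hf hg
    | smul a f hfS hf =>
      have : coeffs k m (a • f) = coeff 0 a • coeffs k m f := by
        ext i
        exact coeff_mul_of_mem_span_of_isHomogeneous hg (hS ▸ hfS) a (hm i)
      rw [this]
      exact Submodule.smul_mem _ _ hf
  rw [eq_top_iff]
  intro w _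
  rw [pi_eq_sum_univ' w]
  refine Submodule.sum_mem _ fun i _ => Submodule.smul_mem _ _ ?_
  have := key (g i) (hS ▸ Ideal.subset_span ⟨i, rfl⟩)
  rw [hgm] at this
  convert this using 1

theorem isMinimalGeneratingFamily_of_coeffs {k σ ι : Type*} [Field k] [Fintype ι] [DecidableEq ι]
    {g : ι → MvPolynomial σ k} {d : ℕ} (hg : ∀ i, (g i).IsHomogeneous d) {m : ι → σ →₀ ℕ}
    (hm : ∀ i, (m i).degree = d) (hgm : ∀ i, coeffs k m (g i) = Pi.single i 1) :
    IsMinimalGeneratingFamily (Ideal.span (Set.range g)) g := by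
  refine ⟨rfl, fun S hS => Set.eq_univ_of_forall fun i => ?_⟩
  by_contra hi
  have htop := span_coeffs_image_eq_top hg hm hgm hS
  have hle : Submodule.span k (coeffs k m '' (g '' S)) ≤
      LinearMap.ker (LinearMap.proj i : (ι → k) →ₗ[k] k) := by
    rw [Submodule.span_le]
    rintro _ ⟨_, ⟨j, hj, rfl⟩, rfl⟩
    have hij : i ≠ j := fun h => hi (h ▸ hj)
    simp [hgm, hij]
  have := hle (htop ▸ Submodule.mem_top : (Pi.single i 1 : ι → k) ∈ _)
  simp at this

theorem minNumGenerators_of_coeffs {k σ ι : Type*} [Field k] [Fintype ι] [DecidableEq ι]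
    {g : ι → MvPolynomial σ k} {d : ℕ} (hg : ∀ i, (g i).IsHomogeneous d) {m : ι → σ →₀ ℕ}
    (hm : ∀ i, (m i).degree = d) (hgm : ∀ i, coeffs k m (g i) = Pi.single i 1) :
    minNumGenerators (Ideal.span (Set.range g)) = Fintype.card ι := by
  classical
  refine le_antisymm ?_ ?_
  · refine (Submodule.spanFinrank_span_le_ncard_of_finite (Set.finite_range g)).trans ?_
    rw [← Set.image_univ, ← Nat.card_eq_fintype_card, ← Set.ncard_univ]
    exact Set.ncard_image_le
  · have hfg : (Ideal.span (Set.range g)).FG := Submodule.fg_span (Set.finite_range g)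
    obtain ⟨S, hcard, hS⟩ := Submodule.FG.exists_span_finset_card_eq_spanFinrank hfg
    have htop := span_coeffs_image_eq_top hg hm hgm (S := S) hS
    rw [minNumGenerators, ← hcard]
    have h := finrank_span_finset_le_card (R := k) (S.image (coeffs k m))
    rw [Finset.coe_image, Set.finrank, htop, finrank_top, Module.finrank_fintype_fun_eq_card] at h
    exact h.trans Finset.card_image_le

/-! ### Counting the index sets -/

theorem card_tailIndices {n s : ℕ} (hns : n + 2 ≤ s) (hsn : s ≤ 2 * n) :
    (tailIndices n s).card = s - (n + 1) := by
  have : (tailIndices n s).map Fin.valEmbedding = Finset.Ico (2 * n - s + 1) n := by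
    ext i
    simp only [tailIndices, Finset.mem_map, Finset.mem_filter, Finset.mem_univ, true_and,
      Fin.valEmbedding_apply, Finset.mem_Ico]
    constructor
    · rintro ⟨a, ha, rfl⟩; exact ha
    · intro h; exact ⟨⟨i, by omega⟩, h, rfl⟩
  rw [← Finset.card_map Fin.valEmbedding, this, Nat.card_Ico]
  omega

theorem card_filter_fst_lt_snd (n : ℕ) :
    (Finset.univ.filter fun ij : Fin n × Fin n => ij.1 < ij.2).card = n.choose 2 := by
  rw [Finset.card_filter, Fintype.sum_prod_type_right]
  simp only [← Finset.card_filter]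
  rw [Nat.choose_two_right, ← Finset.sum_range_id, Finset.sum_range]
  refine Finset.sum_congr rfl fun j _ => ?_
  have : (Finset.univ.filter fun i : Fin n => i < j) = Finset.Iio j := by ext; simp
  rw [this, Fin.card_Iio]

theorem card_quadricIndices {n s : ℕ} (hns : n + 2 ≤ s) (hsn : s ≤ 2 * n) :
    (quadricIndices n s).card = (n + 1).choose 2 - (s - (n + 1)) := by
  have hinj : Function.Injective fun t : Fin (n + 1) => (t, Fin.last n) :=
    fun a b h => (Prod.ext_iff.1 h).1
  have heq : quadricIndices n s =
      (Finset.univ.filter fun ij : Fin (n + 1) × Fin (n + 1) => ij.1 < ij.2) \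
        (tailIndices n s).map ⟨_, hinj⟩ := by
    ext ij
    simp only [quadricIndices, Finset.mem_filter, Finset.mem_univ, true_and, Finset.mem_sdiff,
      Finset.mem_map, Function.Embedding.coeFn_mk, not_exists, not_and]
    exact and_congr_right fun _ => forall₂_congr fun t _ => ne_comm
  rw [heq, Finset.card_sdiff_of_subset, card_filter_fst_lt_snd, Finset.card_map,
    card_tailIndices hns hsn]
  intro ij
  simp only [Finset.mem_map, Function.Embedding.coeFn_mk, Finset.mem_filter, Finset.mem_univ,
    true_and, tailIndices]
  rintro ⟨t, ht, rfl⟩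
  exact Fin.lt_def.2 ht.2

theorem mem_quadricIndices_of_not_tail {n s : ℕ} {i j : Fin (n + 1)} (hij : i < j)
    (hi : i ∉ tailIndices n s) : (i, j) ∈ quadricIndices n s := by
  simp only [quadricIndices, Finset.mem_filter, Finset.mem_univ, true_and]
  exact ⟨hij, fun t ht h => hi (by rwa [(Prod.mk.inj h).1])⟩

theorem mem_quadricIndices_or {n s : ℕ} {i j : Fin (n + 1)} (hij : i < j) :
    (i, j) ∈ quadricIndices n s ∨ (i ∈ tailIndices n s ∧ j = Fin.last n) := by
  simp only [quadricIndices, Finset.mem_filter, Finset.mem_univ, true_and]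
  by_cases h : i ∈ tailIndices n s ∧ j = Fin.last n
  · exact Or.inr h
  · refine Or.inl ⟨hij, fun t ht h2 => h ?_⟩
    rw [Prod.mk.injEq] at h2
    exact ⟨h2.1 ▸ ht, h2.2⟩

theorem lt_last_of_mem_tailIndices {n s : ℕ} {t : Fin (n + 1)} (ht : t ∈ tailIndices n s) :
    t < Fin.last n := by
  simp only [tailIndices, Finset.mem_filter] at ht
  exact Fin.lt_def.2 ht.2.2

theorem zero_notMem_tailIndices {n s : ℕ} : (0 : Fin (n + 1)) ∉ tailIndices n s := by
  simp [tailIndices]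

theorem fst_lt_snd_of_quadricIndices {n s : ℕ} (ij : quadricIndices n s) : ij.1.1 < ij.1.2 := by
  have := ij.2
  simp only [quadricIndices, Finset.mem_filter] at this
  exact this.2.1

/-! ### Coefficients and values of the quadrics -/

theorem quadric_isHomogeneous {k : Type*} [Field k] {n s : ℕ}
    (α : quadricIndices n s → tailIndices n s → k) (ij : quadricIndices n s) :
    (quadric α ij).IsHomogeneous 2 := by
  refine ((isHomogeneous_X k _).mul (isHomogeneous_X k _)).add
    (IsHomogeneous.sum _ _ _ fun t _ => ?_)
  have := ((isHomogeneous_C (Fin (n + 1)) (α ij t)).mul (isHomogeneous_X k t.1)).mul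
    (isHomogeneous_X k (Fin.last n))
  exact this

/-- The exponent of the leading monomial `x_i x_j` of `g_ij`. -/
noncomputable def leadingExponent {n s : ℕ} (ij : quadricIndices n s) : Fin (n + 1) →₀ ℕ :=
  Finsupp.single ij.1.1 1 + Finsupp.single ij.1.2 1

theorem degree_leadingExponent {n s : ℕ} (ij : quadricIndices n s) :
    (leadingExponent ij).degree = 2 := by
  simp [leadingExponent, Finsupp.degree_single]

theorem single_add_single_inj {σ : Type*} [LinearOrder σ] {i j i' j' : σ} (h : i < j) (h' : i' < j')
    (heq : Finsupp.single i 1 + Finsupp.single j 1 =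
      (Finsupp.single i' 1 + Finsupp.single j' 1 : σ →₀ ℕ)) : i = i' ∧ j = j' := by
  have hi := DFunLike.congr_fun heq i
  have hj := DFunLike.congr_fun heq j
  simp only [Finsupp.add_apply, Finsupp.single_apply] at hi hj
  grind

/-- The tail monomials `x_t x_n` are exactly those excluded from `Λ`, so each leading monomial
occurs only in its own quadric. -/
theorem coeffs_quadric {k : Type*} [Field k] {n s : ℕ}
    (α : quadricIndices n s → tailIndices n s → k) (ij : quadricIndices n s) :
    coeffs k leadingExponent (quadric α ij) = Pi.single ij 1 := by
  have hcoeff : ∀ (m : Fin (n + 1) →₀ ℕ) (i j : Fin (n + 1)),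
      coeff m (X i * X j : MvPolynomial (Fin (n + 1)) k) =
        if Finsupp.single i 1 + Finsupp.single j 1 = m then 1 else 0 := by
    intro m i j
    rw [X, X, monomial_mul, one_mul, coeff_monomial]
  ext uv
  have huv := fst_lt_snd_of_quadricIndices uv
  have htail : coeff (leadingExponent uv)
      (∑ t : tailIndices n s, C (α ij t) * X t.1 * X (Fin.last n)) = 0 := by
    rw [coeff_sum]
    refine Finset.sum_eq_zero fun t _ => ?_
    rw [mul_assoc, coeff_C_mul, hcoeff, if_neg, mul_zero]
    intro h
    obtain ⟨h1, h2⟩ := single_add_single_inj (lt_last_of_mem_tailIndices t.2) huv h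
    have h3 := uv.2
    simp only [quadricIndices, Finset.mem_filter] at h3
    exact h3.2.2 t.1 t.2 (Prod.ext h1.symm h2.symm)
  change coeff (leadingExponent uv) (quadric α ij) = _
  rw [quadric, coeff_add, htail, add_zero, hcoeff, Pi.single_apply]
  refine if_congr ⟨fun h => ?_, fun h => by rw [h]; rfl⟩ rfl rfl
  obtain ⟨h1, h2⟩ := single_add_single_inj (fst_lt_snd_of_quadricIndices ij) huv h
  exact Subtype.ext (Prod.ext h1.symm h2.symm)

theorem eval_quadric {k : Type*} [Field k] {n s : ℕ}
    (α : quadricIndices n s → tailIndices n s → k) (ij : quadricIndices n s)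
    (v : Fin (n + 1) → k) : eval v (quadric α ij) =
      v ij.1.1 * v ij.1.2 + ∑ t : tailIndices n s, α ij t * (v t.1 * v (Fin.last n)) := by
  simp [quadric, mul_assoc]

theorem sum_dite_mem_mul {k σ : Type*} [CommRing k] [Fintype σ] [DecidableEq σ] (T : Finset σ)
    (a : T → k) (v : σ → k) :
    ∑ i, (if h : i ∈ T then a ⟨i, h⟩ else 0) * v i = ∑ t : T, a t * v t := by
  rw [← Finset.sum_subset (Finset.subset_univ T)
    (fun i _ hi => by rw [dif_neg hi, zero_mul]), ← Finset.sum_coe_sort]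
  exact Finset.sum_congr rfl fun t _ => by rw [dif_pos t.2]

/-! ### The quadrics exist, are unique and generate -/

/-- The generators of an ideal `J` of polynomials vanishing on the coordinate axes and on lines
through further vectors `v p` satisfying a general position condition. -/
theorem exists_quadric_span_eq {k P : Type*} [Field k] [Infinite k] [Fintype P] {n s : ℕ}
    (hns : n + 2 ≤ s) (hsn : s ≤ 2 * n) (hP : Fintype.card P = s - (n + 1))
    (v : P → Fin (n + 1) → k)
    (hgen : ∀ (w : Fin (n + 1) → k) (S : Finset P) (Z : Finset (Fin (n + 1))),
      (∀ p ∈ S, ∑ i, w i * v p i = 0) → (∀ i ∈ Z, w i = 0) → n + 1 ≤ S.card + Z.card → w = 0)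
    {J : Ideal (MvPolynomial (Fin (n + 1)) k)}
    (hJ : ∀ f, f ∈ J ↔ (∀ i c, eval (Pi.single i c) f = 0) ∧ ∀ p (c : k), eval (c • v p) f = 0) :
    ∃ α : quadricIndices n s → tailIndices n s → k,
      Ideal.span (Set.range (quadric α)) = J ∧
      ∀ β : quadricIndices n s → tailIndices n s → k, (∀ ij, quadric β ij ∈ J) → β = α := by
  classical
  have hT := card_tailIndices hns hsn
  -- Otherwise `x_n = 0` contains `p` and the `n` other coordinate points.
  have hlast : ∀ p, v p (Fin.last n) ≠ 0 := by
    intro p h0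
    have := hgen (Pi.single (Fin.last n) 1) {p} (Finset.univ.erase (Fin.last n))
      (by simpa [Pi.single_apply] using h0)
      (fun i hi => by simp [Finset.ne_of_mem_erase hi])
      (by simp [Finset.card_erase_of_mem, add_comm])
    simpa using congrFun this (Fin.last n)
  let L : (tailIndices n s → k) →ₗ[k] P → k := LinearMap.pi fun p =>
    ∑ t : tailIndices n s, (v p t.1 * v p (Fin.last n)) • LinearMap.proj t
  have hL : ∀ a p, L a p = ∑ t : tailIndices n s, a t * (v p t.1 * v p (Fin.last n)) := by
    intro a p
    simp only [L, LinearMap.pi_apply, LinearMap.sum_apply, LinearMap.smul_apply,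
      LinearMap.proj_apply, smul_eq_mul]
    exact Finset.sum_congr rfl fun t _ => mul_comm _ _
  have hLinj : Function.Injective L := by
    rw [injective_iff_map_eq_zero]
    intro a ha
    -- After division by `x_n(p)`, the form `∑ a_t x_t` vanishes on all of `P` and at the coordinate
    -- points outside `T`: `|P| + (n + 1 - |T|) = n + 1` points.
    have := hgen (fun i => if h : i ∈ tailIndices n s then a ⟨i, h⟩ else 0) Finset.univ
      (tailIndices n s)ᶜ (fun p _ => ?_) (fun i hi => dif_neg (Finset.mem_compl.1 hi)) ?_
    · ext t
      simpa using congrFun this t.1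
    · have h1 := congrFun ha p
      rw [hL] at h1
      simp only [← mul_assoc, ← Finset.sum_mul, Pi.zero_apply, mul_eq_zero, hlast p, or_false] at h1
      rw [sum_dite_mem_mul, h1]
    · rw [Finset.card_compl, Finset.card_univ, Fintype.card_fin, hT, hP]
      omega
  have hLsurj : Function.Surjective L := by
    rw [← LinearMap.injective_iff_surjective_of_finrank_eq_finrank]
    · exact hLinj
    · simp [hP, hT]
  have hquad : ∀ β : quadricIndices n s → tailIndices n s → k, ∀ ij, quadric β ij ∈ J ↔
      L (β ij) = fun p => -(v p ij.1.1 * v p ij.1.2) := by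
    intro β ij
    have hij := fst_lt_snd_of_quadricIndices ij
    rw [hJ]
    constructor
    · rintro ⟨_, h⟩
      ext p
      have h1 := h p 1
      rw [one_smul, eval_quadric, ← hL] at h1
      exact eq_neg_of_add_eq_zero_right h1
    · intro h
      refine ⟨fun i c => ?_, fun p c => ?_⟩
      · have h0 : ∀ a b : Fin (n + 1), a < b →
            (Pi.single i c : Fin (n + 1) → k) a * (Pi.single i c : Fin (n + 1) → k) b = 0 := by
          intro a b hab
          by_cases hai : a = i
          · rw [Pi.single_eq_of_ne (i' := b) (fun hb => hab.ne (hai.trans hb.symm)), mul_zero]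
          · rw [Pi.single_eq_of_ne hai, zero_mul]
        rw [eval_quadric, h0 _ _ hij, zero_add]
        refine Finset.sum_eq_zero fun t _ => ?_
        rw [h0 _ _ (lt_last_of_mem_tailIndices t.2), mul_zero]
      · rw [eval_smul_of_isHomogeneous (quadric_isHomogeneous β ij), eval_quadric, ← hL, h]
        ring
  choose α hα using fun ij : quadricIndices n s => hLsurj fun p => -(v p ij.1.1 * v p ij.1.2)
  refine ⟨α, le_antisymm ?_ fun f hf => ?_, fun β hβ => funext fun ij => hLinj ?_⟩
  · rw [Ideal.span_le]
    rintro _ ⟨ij, rfl⟩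
    exact (hquad α ij).2 (hα ij)
  · have hQJ : Ideal.span (Set.range (quadric α)) ≤ J := by
      rw [Ideal.span_le]
      rintro _ ⟨ij, rfl⟩
      exact (hquad α ij).2 (hα ij)
    have hlead : ∀ ij : quadricIndices n s, X ij.1.1 * X ij.1.2 - ∑ t ∈ tailIndices n s,
        C (if h : t ∈ tailIndices n s then -α ij ⟨t, h⟩ else 0) * X t * X (Fin.last n) ∈
          Ideal.span (Set.range (quadric α)) := by
      intro ij
      refine Ideal.subset_span ⟨ij, ?_⟩
      rw [quadric, sub_eq_add_neg, ← Finset.sum_neg_distrib,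
        ← Finset.sum_coe_sort (tailIndices n s)]
      congr 1
      refine Finset.sum_congr rfl fun t _ => ?_
      rw [dif_pos t.2, map_neg]
      ring
    have hrel : ∀ i j : Fin (n + 1), i < j → ∃ a : Fin (n + 1) → k, X i * X j -
        ∑ t ∈ tailIndices n s, C (a t) * X t * X (Fin.last n) ∈
          Ideal.span (Set.range (quadric α)) := by
      intro i j hij
      obtain h | ⟨hi, rfl⟩ := mem_quadricIndices_or (s := s) hij
      · exact ⟨_, hlead ⟨(i, j), h⟩⟩
      · refine ⟨Pi.single i 1, ?_⟩
        rw [Finset.sum_eq_single i (fun u _ hu => by simp [hu]) (fun h => absurd hi h)]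
        simp
    have hpos : (0 : Fin (n + 1)) < Fin.last n := Fin.lt_def.2 (by simp; omega)
    let o : quadricIndices n s :=
      ⟨(0, Fin.last n), mem_quadricIndices_of_not_tail hpos zero_notMem_tailIndices⟩
    have hαo : ∀ t, α o t ≠ 0 := by
      intro t₀ h0
      -- If `α o t₀ = 0`, the form `x_0 + ∑ α_t x_t` vanishes on `P`, at `t₀`, and at the coordinate
      -- points outside `T ∪ {0}`. Gaining `t₀` makes up for losing `0`, so again there are `n + 1`
      -- points.
      have h := hgen (fun i => (if i = 0 then 1 else 0) +
          if h : i ∈ tailIndices n s then α o ⟨i, h⟩ else 0) Finset.univ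
        ((insert 0 (tailIndices n s)).erase t₀.1)ᶜ (fun p _ => ?_) (fun i hi => ?_) ?_
      · have := congrFun h 0
        simp [zero_notMem_tailIndices] at this
      · refine (mul_eq_zero.1 (?_ : _ * v p (Fin.last n) = 0)).resolve_right (hlast p)
        have h1 := congrFun (hα o) p
        rw [hL, eq_neg_iff_add_eq_zero] at h1
        refine Eq.trans ?_ h1
        simp only [add_mul, Finset.sum_add_distrib]
        rw [sum_dite_mem_mul, add_comm]
        congr 1
        · rw [Finset.sum_mul]
          exact Finset.sum_congr rfl fun t _ => mul_assoc _ _ _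
        · simp [o]
      · simp only [Finset.mem_compl, Finset.mem_erase, Finset.mem_insert, not_and, not_or] at hi
        by_cases hit : i = t₀.1
        · subst hit
          rw [if_neg (fun h => zero_notMem_tailIndices (h ▸ t₀.2)), dif_pos t₀.2, zero_add]
          exact h0
        · rw [if_neg (hi hit).1, dif_neg (hi hit).2, zero_add]
      · rw [Finset.card_compl, Finset.card_erase_of_mem (Finset.mem_insert_of_mem t₀.2),
          Finset.card_insert_of_notMem zero_notMem_tailIndices, Finset.card_univ, Fintype.card_fin,
          hT, hP]
        omega
    obtain ⟨h, hh⟩ := exists_sub_sum_mem_of_relations _ (tailIndices n s) (Fin.last n) 0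
      zero_notMem_tailIndices
      (fun i j hij => by
        rcases hij.lt_or_gt with hlt | hlt
        · exact hrel i j hlt
        · rw [mul_comm (X i)]; exact hrel j i hlt)
      _ (fun t ht => by rw [dif_pos ht]; exact neg_ne_zero.2 (hαo _)) (hlead o)
      (mem_span_X_mul_X_of_eval_single ((hJ f).1 hf).1)
    have hG := J.sub_mem hf (hQJ hh)
    rw [sub_sub_cancel] at hG
    have hzero : ∀ t ∈ tailIndices n s, h t = 0 := by
      have heval : ∀ c : k, (fun t : tailIndices n s => c ^ 2 * (h t.1).eval c) = 0 := by
        intro c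
        refine hLinj ?_
        rw [map_zero]
        ext p
        -- The scaling gives the point last coordinate `c`, so that `h t` is evaluated at the same
        -- `c` for every `p`. Up to the factor `v p (Fin.last n) ^ 2`, the vanishing is the `p`-th
        -- coordinate of `L` at `c ^ 2 * h_t(c)`.
        have h1 := ((hJ _).1 hG).2 p (c / v p (Fin.last n))
        have h2 : ∀ q : Polynomial k, eval ((c / v p (Fin.last n)) • v p)
            (Polynomial.aeval (X (Fin.last n)) q) = q.eval c := by
          intro q
          rw [← coe_aeval_eq_eval, RingHom.coe_coe, ← Polynomial.aeval_algHom_apply, aeval_X,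
            Pi.smul_apply, smul_eq_mul, div_mul_cancel₀ _ (hlast p), Polynomial.coe_aeval_eq_eval]
        simp only [map_sum, map_mul, eval_X, h2] at h1
        rw [hL, Pi.zero_apply, ← mul_zero (v p (Fin.last n) ^ 2), ← h1, Finset.mul_sum]
        refine (?_ : _ = _).trans (Finset.sum_coe_sort (tailIndices n s) _)
        refine Finset.sum_congr rfl fun t _ => ?_
        have := hlast p
        simp only [Pi.smul_apply, smul_eq_mul]
        field_simp
      intro t ht
      have h0 : Polynomial.X ^ 2 * h t = 0 := Polynomial.funext fun c => by
        simpa using congrFun (heval c) ⟨t, ht⟩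
      exact (mul_eq_zero.1 h0).resolve_left (pow_ne_zero _ Polynomial.X_ne_zero)
    rw [Finset.sum_eq_zero (fun t ht => by rw [hzero t ht, map_zero, mul_zero]), sub_zero] at hh
    exact hh
  · rw [(hquad β ij).1 (hβ ij), hα]

/-! ### General position and the standard frame -/

/-- No `n + 1` points of `Γ` lie on a hyperplane. -/
def AvoidsHyperplanes {k : Type*} [Field k] {n : ℕ} (Γ : Set (ProjSpace k n)) : Prop :=
  ∀ S ⊆ Γ, S.encard = (n : ℕ∞) + 1 →
    ∀ ℓ : Module.Dual k (Fin (n + 1) → k), S ⊆ hyperplane ℓ → ℓ = 0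

theorem InGeneralLinearPosition.avoidsHyperplanes {k : Type*} [Field k] {n : ℕ}
    {Γ : Set (ProjSpace k n)} (hΓ : InGeneralLinearPosition Γ)
    (hcard : (n : ℕ∞) + 1 ≤ Γ.encard) : AvoidsHyperplanes Γ := by
  obtain ⟨h, _⟩ | ⟨_, h⟩ := hΓ
  · have h1 := hcard.trans h
    norm_cast at h1
    omega
  · intro S hS hSc ℓ hℓ
    by_contra h0
    exact h S hS hSc ℓ h0 hℓ

theorem mk_mem_hyperplane_iff {k : Type*} [Field k] {n : ℕ} {v : Fin (n + 1) → k} (hv : v ≠ 0)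
    (ℓ : Module.Dual k (Fin (n + 1) → k)) :
    Projectivization.mk k v hv ∈ hyperplane ℓ ↔ ℓ v = 0 := by
  rw [hyperplane, Set.mem_ofPred_eq, Projectivization.submodule_mk,
    Submodule.span_singleton_le_iff_mem, LinearMap.mem_ker]

theorem mem_hyperplane_iff {k : Type*} [Field k] {n : ℕ} {p : ProjSpace k n}
    (ℓ : Module.Dual k (Fin (n + 1) → k)) : p ∈ hyperplane ℓ ↔ ℓ p.rep = 0 := by
  rw [← mk_mem_hyperplane_iff p.rep_nonzero, p.mk_rep]

theorem AvoidsHyperplanes.changeCoordinates {k : Type*} [Field k] {n : ℕ}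
    {Γ : Set (ProjSpace k n)} (hΓ : AvoidsHyperplanes Γ)
    (A : (Fin (n + 1) → k) ≃ₗ[k] (Fin (n + 1) → k)) :
    AvoidsHyperplanes (changeCoordinates A Γ) := by
  intro S hS hSc ℓ hℓ
  obtain ⟨S', hS', rfl⟩ := Set.subset_image_iff.1 hS
  rw [(Projectivization.map_injective _ A.injective).encard_image] at hSc
  have h0 : ℓ ∘ₗ (A : (Fin (n + 1) → k) →ₗ[k] (Fin (n + 1) → k)) = 0 := by
    refine hΓ S' hS' hSc _ fun p hp => ?_
    have h1 := hℓ (Set.mem_image_of_mem _ hp)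
    induction p using Projectivization.ind with
    | h v hv =>
      rw [Projectivization.map_mk, mk_mem_hyperplane_iff] at h1
      rwa [mk_mem_hyperplane_iff]
  ext i
  have := LinearMap.congr_fun h0 (A.symm (Pi.single i 1))
  simpa using this

/-- Any `n + 1` of the points give a basis. A further point `q` has no zero coordinate in it, since
otherwise `q` and `n` basis points would share a hyperplane. Rescaling the basis by the coordinates
of `q` makes `q` the unit point. -/
theorem exists_containsStandardFrame {k : Type*} [Field k] {n : ℕ} {Γ : Set (ProjSpace k n)}
    (hΓ : AvoidsHyperplanes Γ) (hcard : (n : ℕ∞) + 2 ≤ Γ.encard) :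
    ∃ A : (Fin (n + 1) → k) ≃ₗ[k] (Fin (n + 1) → k),
      ContainsStandardFrame (changeCoordinates A Γ) := by
  have hlt : (n : ℕ∞) + 1 < (n : ℕ∞) + 2 := by norm_cast; omega
  obtain ⟨S, hS, hSc⟩ := Set.exists_subset_encard_eq (hlt.le.trans hcard)
  obtain ⟨q, hq, hqS⟩ : ∃ q ∈ Γ, q ∉ S := by
    by_contra! h
    have := Set.encard_le_encard (show Γ ⊆ S from h)
    rw [hSc] at this
    exact absurd (hcard.trans this) (not_le.2 hlt)
  have hSc' : S.encard = ((n + 1 : ℕ) : ℕ∞) := by rw [hSc]; norm_cast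
  have hSfin : S.Finite := Set.finite_of_encard_eq_coe hSc'
  have : Fintype S := hSfin.fintype
  have hScard : Fintype.card S = n + 1 := by
    rw [← Nat.card_eq_fintype_card, Nat.card_coe_set_eq, Set.ncard, hSc', ENat.toNat_natCast]
  let e : Fin (n + 1) ≃ S := (Fintype.equivFinOfCardEq hScard).symm
  let u : Fin (n + 1) → Fin (n + 1) → k := fun i => (e i).1.rep
  have hspan : ⊤ ≤ Submodule.span k (Set.range u) := by
    by_contra h
    obtain ⟨ℓ, hℓ, hle⟩ := Submodule.exists_le_ker_of_lt_top _ (lt_top_iff_ne_top.2 fun h2 => h h2.ge)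
    refine hℓ (hΓ S hS hSc ℓ fun p hp => ?_)
    rw [mem_hyperplane_iff]
    refine hle (Submodule.subset_span ⟨e.symm ⟨p, hp⟩, ?_⟩)
    simp [u]
  let b : Module.Basis (Fin (n + 1)) k (Fin (n + 1) → k) :=
    basisOfTopLeSpanOfCardEqFinrank u hspan (by simp)
  have hb : ∀ i, b i = u i := fun i => by simp [b]
  have hc : ∀ i, b.repr q.rep i ≠ 0 := by
    intro i h0
    have hcoord : b.coord i = 0 := by
      refine hΓ (insert q (S \ {(e i).1})) (Set.insert_subset hq (Set.sdiff_subset.trans hS)) ?_ _ ?_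
      · rw [Set.encard_insert_of_notMem fun h => hqS h.1, Set.encard_sdiff_singleton_add_one (e i).2,
          hSc]
      · refine Set.insert_subset ?_ fun p hp => ?_
        · rwa [mem_hyperplane_iff]
        · rw [mem_hyperplane_iff]
          have hp' : p.rep = b (e.symm ⟨p, hp.1⟩) := by simp [hb, u]
          rw [hp', b.coord_apply, b.repr_self, Finsupp.single_apply, if_neg]
          rintro h
          exact hp.2 (by simp [← h])
    have := LinearMap.congr_fun hcoord (b i)
    simp at this
  let b' := b.unitsSMul fun i => Units.mk0 _ (hc i)
  have hb' : ∀ i, b' i = b.repr q.rep i • u i := fun i => by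
    rw [Module.Basis.unitsSMul_apply, hb]; rfl
  refine ⟨b'.equivFun, fun i => ⟨(e i).1, hS (e i).2, ?_⟩, q, hq, ?_⟩
  · have h1 : (e i).1 = Projectivization.mk k (b' i) (b'.ne_zero i) := by
      rw [← (e i).1.mk_rep, Projectivization.mk_eq_mk_iff']
      exact ⟨(b.repr q.rep i)⁻¹, by rw [hb', smul_smul, inv_mul_cancel₀ (hc i), one_smul]⟩
    rw [h1, Projectivization.map_mk, Projectivization.mk_eq_mk_iff']
    exact ⟨1, by
      ext j
      simp [Pi.single_apply, eq_comm]⟩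
  · have h1 : q.rep = ∑ i, b' i := by
      refine (b.sum_repr q.rep).symm.trans (Finset.sum_congr rfl fun i _ => ?_)
      rw [hb', hb]
    rw [← q.mk_rep, Projectivization.map_mk, Projectivization.mk_eq_mk_iff']
    refine ⟨1, ?_⟩
    rw [one_smul, h1]
    ext j
    simp [Finsupp.single_apply]

theorem exists_quadrics_generating {k : Type*} [Field k] [Infinite k] {n s : ℕ}
    (hns : n + 2 ≤ s) (hsn : s ≤ 2 * n) {Γ : Set (ProjSpace k n)} (hcard : Γ.encard = s)
    (hΓ : AvoidsHyperplanes Γ) (hframe : ContainsStandardFrame Γ) :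
    ∃ α : quadricIndices n s → tailIndices n s → k,
      Ideal.span (Set.range (quadric α)) = idealOfPoints Γ ∧
      ∀ β : quadricIndices n s → tailIndices n s → k,
        (∀ ij, quadric β ij ∈ idealOfPoints Γ) → β = α := by
  classical
  let E : Fin (n + 1) → ProjSpace k n := fun i =>
    Projectivization.mk k (Pi.single i (1 : k)) (by simp)
  have hEinj : Function.Injective E := by
    intro i j h
    obtain ⟨c, hc⟩ := (Projectivization.mk_eq_mk_iff' k _ _ _ _).1 h
    by_contra hij
    simpa [Pi.single_eq_of_ne hij] using congrFun hc i
  have hEΓ : Set.range E ⊆ Γ := by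
    rintro _ ⟨i, rfl⟩
    exact hframe.1 i
  have hΓfin : Γ.Finite := Set.finite_of_encard_eq_coe hcard
  have : Fintype ↥(Γ \ Set.range E) := (hΓfin.subset Set.sdiff_subset).fintype
  have hP : Fintype.card ↥(Γ \ Set.range E) = s - (n + 1) := by
    have h1 : Set.ncard Γ = s := by rw [Set.ncard, hcard, ENat.toNat_natCast]
    have h2 : (Set.range E).ncard = n + 1 := by
      rw [← Set.image_univ, Set.ncard_image_of_injective _ hEinj, Set.ncard_univ]
      simp
    rw [← Nat.card_eq_fintype_card, Nat.card_coe_set_eq,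
      Set.ncard_sdiff hEΓ (Set.finite_range E), h1, h2]
  refine exists_quadric_span_eq hns hsn hP (fun p => p.1.rep) (fun w S Z hS hZ hSZ => ?_)
    fun f => ?_
  · let R : Finset (ProjSpace k n) := S.map (Function.Embedding.subtype _) ∪ Z.map ⟨E, hEinj⟩
    have hR : R.card = S.card + Z.card := by
      rw [Finset.card_union_of_disjoint, Finset.card_map, Finset.card_map]
      rw [Finset.disjoint_left]
      intro p hp hp2
      obtain ⟨p, _, rfl⟩ := Finset.mem_map.1 hp
      obtain ⟨i, _, hi⟩ := Finset.mem_map.1 hp2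
      exact p.2.2 ⟨i, hi⟩
    -- General position speaks of exactly `n + 1` points, so the set is cut down to that size.
    obtain ⟨R', hR', hR'c⟩ := Finset.exists_subset_card_eq (hSZ.trans_eq hR.symm)
    have hmem : ∀ p ∈ R, p ∈ Γ ∧ p ∈ hyperplane (dotProductEquiv k (Fin (n + 1)) w) := by
      intro p hp
      rcases Finset.mem_union.1 hp with hp | hp
      · obtain ⟨p, hpS, rfl⟩ := Finset.mem_map.1 hp
        exact ⟨p.2.1, (mem_hyperplane_iff _).2 (hS p hpS)⟩
      · obtain ⟨i, hi, rfl⟩ := Finset.mem_map.1 hp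
        refine ⟨hEΓ ⟨i, rfl⟩, (mk_mem_hyperplane_iff _ _).2 ?_⟩
        simp [hZ i hi]
    have h0 := hΓ (R' : Set (ProjSpace k n)) (fun p hp => (hmem p (hR' hp)).1)
      (by rw [Set.encard_coe_eq_coe_finsetCard, hR'c]; norm_cast) _
      (fun p hp => (hmem p (hR' hp)).2)
    exact (LinearEquiv.map_eq_zero_iff _).1 h0
  · rw [mem_idealOfPoints_iff]
    constructor
    · refine fun h => ⟨fun i c => h _ (hEΓ ⟨i, rfl⟩) _ ?_, fun p c => h _ p.2.1 _ ?_⟩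
      · rw [Projectivization.submodule_mk, Submodule.mem_span_singleton]
        exact ⟨c, by rw [← Pi.single_smul, smul_eq_mul, mul_one]⟩
      · rw [Projectivization.submodule_eq]
        exact Submodule.smul_mem _ _ (Submodule.mem_span_singleton_self _)
    · rintro ⟨h1, h2⟩ p hp v hv
      by_cases hpE : p ∈ Set.range E
      · obtain ⟨i, rfl⟩ := hpE
        rw [Projectivization.submodule_mk, Submodule.mem_span_singleton] at hv
        obtain ⟨c, rfl⟩ := hv
        rw [← Pi.single_smul]
        exact h1 _ _
      · rw [Projectivization.submodule_eq, Submodule.mem_span_singleton] at hv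
        obtain ⟨c, rfl⟩ := hv
        exact h2 ⟨p, hp, hpE⟩ c

/-! ### Invariance of the number of generators -/

/-- Linear substitution of variables. -/
noncomputable def linearSubst {k σ : Type*} [CommRing k] [Fintype σ] [DecidableEq σ]
    (B : (σ → k) →ₗ[k] (σ → k)) : MvPolynomial σ k →ₐ[k] MvPolynomial σ k :=
  aeval fun i => ∑ j, C (B (Pi.single j 1) i) * X j

theorem eval_linearSubst {k σ : Type*} [CommRing k] [Fintype σ] [DecidableEq σ]
    (B : (σ → k) →ₗ[k] (σ → k)) (v : σ → k) (f : MvPolynomial σ k) :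
    eval v (linearSubst B f) = eval (B v) f := by
  have h : (aeval v).comp (linearSubst B) = (aeval (B v) : MvPolynomial σ k →ₐ[k] k) := by
    refine MvPolynomial.algHom_ext fun i => ?_
    have hv : B v i = ∑ j, v j * B (Pi.single j 1) i := by
      conv_lhs => rw [pi_eq_sum_univ' v, map_sum]
      rw [Finset.sum_apply]
      refine Finset.sum_congr rfl fun j _ => ?_
      rw [map_smul, Pi.smul_apply, smul_eq_mul]
    simp [linearSubst, hv, mul_comm]
  have := AlgHom.congr_fun h f
  simpa only [AlgHom.comp_apply, aeval_eq_eval] using this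

theorem linearSubst_linearSubst {k σ : Type*} [Field k] [Infinite k] [Fintype σ] [DecidableEq σ]
    (B B' : (σ → k) →ₗ[k] (σ → k)) (h : ∀ v, B' (B v) = v) (f : MvPolynomial σ k) :
    linearSubst B (linearSubst B' f) = f :=
  MvPolynomial.funext fun v => by rw [eval_linearSubst, eval_linearSubst, h]

/-- The ring automorphism `f ↦ f ∘ A` carries the ideal of `AΓ` onto that of `Γ`. -/
theorem minNumGenerators_changeCoordinates {k : Type*} [Field k] [Infinite k] {n : ℕ}
    (A : (Fin (n + 1) → k) ≃ₗ[k] (Fin (n + 1) → k)) (Γ : Set (ProjSpace k n)) :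
    minNumGenerators (idealOfPoints (changeCoordinates A Γ)) =
      minNumGenerators (idealOfPoints Γ) := by
  let Φ : MvPolynomial (Fin (n + 1)) k ≃+* MvPolynomial (Fin (n + 1)) k :=
    RingEquiv.ofRingHom (linearSubst A.toLinearMap).toRingHom
      (linearSubst A.symm.toLinearMap).toRingHom
      (RingHom.ext fun f => linearSubst_linearSubst _ _ A.symm_apply_apply f)
      (RingHom.ext fun f => linearSubst_linearSubst _ _ A.apply_symm_apply f)
  have hΦ : ∀ v f, eval v (Φ.symm f) = eval (A.symm v) f := fun v f => eval_linearSubst _ v f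
  have hsub : ∀ p : ProjSpace k n, (Projectivization.map A.toLinearMap A.injective p).submodule =
      p.submodule.map A.toLinearMap := by
    intro p
    induction p using Projectivization.ind with
    | h v hv =>
      rw [Projectivization.map_mk, Projectivization.submodule_mk, Projectivization.submodule_mk,
        Submodule.map_span, Set.image_singleton]
  have hmap : (idealOfPoints (changeCoordinates A Γ)).map (Φ : _ →+* _) = idealOfPoints Γ := by
    ext f
    rw [Ideal.map_comap_of_equiv, Ideal.mem_comap, mem_idealOfPoints_iff, mem_idealOfPoints_iff,
      changeCoordinates, Set.forall_mem_image]
    refine forall₂_congr fun p _ => ?_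
    rw [hsub]
    constructor
    · intro h v hv
      have := h (A v) (Submodule.mem_map_of_mem hv)
      rwa [hΦ, A.symm_apply_apply] at this
    · rintro h _ ⟨v, hv, rfl⟩
      rw [hΦ]
      simpa using h v hv
  rw [minNumGenerators, minNumGenerators, ← hmap]
  exact (Ideal.spanFinrank_map_eq_of_ringEquiv Φ _).symm

/-! ### The main theorem -/

theorem theorem2p2 {k : Type*} [Field k] [IsAlgClosed k] (n s : ℕ)
    (hns : n + 2 ≤ s) (hsn : s ≤ 2 * n)
    (Γ : Set (ProjSpace k n)) (hcard : Γ.encard = s) (hΓ : InGeneralLinearPosition Γ) :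
    -- suitable coordinates exist
    (∃ A : (Fin (n + 1) → k) ≃ₗ[k] (Fin (n + 1) → k),
      ContainsStandardFrame (changeCoordinates A Γ)) ∧
    -- the generators in such coordinates, with uniquely determined coefficients
    (∀ A : (Fin (n + 1) → k) ≃ₗ[k] (Fin (n + 1) → k),
      ContainsStandardFrame (changeCoordinates A Γ) →
      ∃ α : quadricIndices n s → tailIndices n s → k,
        IsMinimalGeneratingFamily (idealOfPoints (changeCoordinates A Γ)) (quadric α) ∧
        ∀ β : quadricIndices n s → tailIndices n s → k,
          (∀ ij, quadric β ij ∈ idealOfPoints (changeCoordinates A Γ)) → β = α) ∧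
    -- the minimal number of generators
    minNumGenerators (idealOfPoints Γ) = (quadricIndices n s).card ∧
    (quadricIndices n s).card = (n + 1).choose 2 - (s - (n + 1)) ∧
    minNumGenerators (idealOfPoints Γ) = (n + 2).choose 2 - s ∧
    n.choose 2 + 1 ≤ minNumGenerators (idealOfPoints Γ) ∧
    minNumGenerators (idealOfPoints Γ) ≤ (n + 1).choose 2 + 1 := by
  have : Infinite k := IsAlgClosed.instInfinite
  have hle : (n : ℕ∞) + 2 ≤ Γ.encard := by rw [hcard]; exact_mod_cast hns
  have hav : AvoidsHyperplanes Γ := hΓ.avoidsHyperplanes (le_trans (by norm_cast; omega) hle)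
  have hgen : ∀ A : (Fin (n + 1) → k) ≃ₗ[k] (Fin (n + 1) → k),
      ContainsStandardFrame (changeCoordinates A Γ) →
      ∃ α : quadricIndices n s → tailIndices n s → k,
        Ideal.span (Set.range (quadric α)) = idealOfPoints (changeCoordinates A Γ) ∧
        ∀ β : quadricIndices n s → tailIndices n s → k,
          (∀ ij, quadric β ij ∈ idealOfPoints (changeCoordinates A Γ)) → β = α := fun A hA =>
    exists_quadrics_generating hns hsn
      (((Projectivization.map_injective _ A.injective).encard_image Γ).trans hcard)
      (hav.changeCoordinates A) hA
  have hframe := exists_containsStandardFrame hav hle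
  have hmu : minNumGenerators (idealOfPoints Γ) = (quadricIndices n s).card := by
    obtain ⟨A, hA⟩ := hframe
    obtain ⟨α, hα, -⟩ := hgen A hA
    rw [← minNumGenerators_changeCoordinates A, ← hα, minNumGenerators_of_coeffs
      (quadric_isHomogeneous α) degree_leadingExponent (coeffs_quadric α), Fintype.card_coe]
  have h1 := card_quadricIndices hns hsn
  -- Pascal's rule makes the remaining claims linear in `n.choose 2`, `n` and `s`; the lower bound
  -- is attained at `s = 2n`.
  have h2 : (n + 1).choose 2 = n + n.choose 2 := by
    rw [Nat.choose_succ_succ' n 1, Nat.choose_one_right]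
  have h3 : (n + 2).choose 2 = n + 1 + (n + 1).choose 2 := by
    rw [Nat.choose_succ_succ' (n + 1) 1, Nat.choose_one_right]
  refine ⟨hframe, fun A hA => ?_, hmu, h1, ?_, ?_, ?_⟩
  · obtain ⟨α, hα, huniq⟩ := hgen A hA
    refine ⟨α, ?_, huniq⟩
    rw [← hα]
    exact isMinimalGeneratingFamily_of_coeffs (quadric_isHomogeneous α) degree_leadingExponent
      (coeffs_quadric α)
  all_goals omega
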